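/- Let $\pm[n]=\{\pm1,\dots,\pm n\}$ and let $D_n$ be the set of permutations $\pi$ of $\pm[n]$ with $\pi(-i)=-\pi(i)$ for all $i$ and with an even number of negative entries among $\pi(1),\dots,\pi(n)$. Let $$D_n(x)=\sum_{\pi\in D_n}x^{\mathrm{des}_D(\pi)},\qquad \mathrm{des}_D(\pi)=|\{i\in\{1,\dots,n\}:\pi(i-1)>\pi(i)\}|,\quad \pi(0):=-\pi(2),$$ be the Eulerian polynomial of type $D$. Define the tangent numbers $T(n,1)$ and the Euler (secant) numbers $S(n,0)$ by $$\tan x=\sum_{n\ge 1}T(n,1)\frac{x^n}{n!},\qquad \sec x=\sum_{n\ge 0}S(n,0)\frac{x^n}{n!}.$$ Then $D_{2n-1}(-1)=0$ for every $n\ge 2$, and for every $n\ge 1$ $$D_{2n}(-1)=(-4)^n\bigl(S(2n,0)-n\,T(2n-1,1)\bigr).$$ -/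

import Mathlib

noncomputable section

/-- The set `±[n] = {±1, …, ±n}`. -/
def plusMinus (n : ℕ) : Finset ℤ := (Finset.Icc (-(n : ℤ)) n).erase 0

/-- The value `π(i)` of a permutation `π` of `±[n]` at an integer `i`; integers outside `±[n]` are
fixed (this matters only for `π(2)` when `n ≤ 1`). -/
def permValue {n : ℕ} (π : Equiv.Perm (plusMinus n)) (i : ℤ) : ℤ :=
  Equiv.Perm.ofSubtype π i

/-- The signed permutations of `±[n]`: the permutations `π` with `π(-i) = -π(i)`. -/
def coxeterB (n : ℕ) : Finset (Equiv.Perm (plusMinus n)) :=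
  {π | ∀ i ∈ plusMinus n, permValue π (-i) = -permValue π i}

/-- The elements of `B_n` with an even number of negative entries among `π(1), …, π(n)`. -/
def coxeterD (n : ℕ) : Finset (Equiv.Perm (plusMinus n)) :=
  {π ∈ coxeterB n | Even ({i ∈ Finset.Icc (1 : ℤ) n | permValue π i < 0} : Finset ℤ).card}

/-- The word `π(0) π(1) ⋯ π(n)` with the convention `π(0) = -π(2)`. -/
def wordD {n : ℕ} (π : Equiv.Perm (plusMinus n)) (i : ℤ) : ℤ :=
  if i = 0 then -permValue π 2 else permValue π i

/-- The number of type `D` descents, `|{i ∈ [n] : π(i-1) > π(i)}|` with `π(0) = -π(2)`. -/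
def desD {n : ℕ} (π : Equiv.Perm (plusMinus n)) : ℕ :=
  ({i ∈ Finset.Icc (1 : ℤ) n | wordD π (i - 1) > wordD π i} : Finset ℤ).card

/-- The Eulerian polynomial of type `D`. -/
def eulerianD (n : ℕ) : Polynomial ℤ := ∑ π ∈ coxeterD n, Polynomial.X ^ desD π

/-- The power series of the secant at `0`. -/
def secSeries : PowerSeries ℚ := (PowerSeries.cos ℚ)⁻¹

/-- The power series of the tangent at `0`. -/
def tanSeries : PowerSeries ℚ := PowerSeries.sin ℚ * secSeries

/-- The tangent numbers of order `k`, given by `tan^k(x) = ∑ T(n,k) x^n / n!`. -/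
def tangentNumber (n k : ℕ) : ℚ := (n.factorial : ℚ) * PowerSeries.coeff n (tanSeries ^ k)

/-- The secant numbers of order `k`, given by `sec(x) tan^k(x) = ∑ S(n,k) x^n / n!`. -/
def secantNumber (n k : ℕ) : ℚ :=
  (n.factorial : ℚ) * PowerSeries.coeff n (secSeries * tanSeries ^ k)

end

/-!
Stembridge's identity `D_n(x) = B_n(x) - n 2^(n-1) x A_{n-1}(x)` is seen by pairing the signed words
that differ only in the sign of the first letter. Writing each factor `x` contributed by a descent
as `1 + (x - 1)` and splitting off the initial descending run of a word, one finds
`e^((x-1)t) A(x,t) = x A(x,t) + 1 - x` and `B(x,t) = e^((x-1)t) A(x,2t)` for the exponential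
generating functions in `t` of the Eulerian polynomials of types `A` and `B`. At `x = -1` they
become `A(-1,t) = 1 - i tan(it)` and `B(-1,t) = sec(2it)`, so that `D_n(-1)` is `(2i)^n` times the
rational number `S(n,0) - (n/2) T(n-1,1)`. For odd `n` this is purely imaginary, hence zero.
-/

open Finset
open scoped Polynomial
open Polynomial (X aeval)

section Arrangements

variable {α : Type*}

/-- The linear arrangements of a finite set: the lists without repetitions in which exactly the
elements of `S` occur. -/
def arrangements (S : Finset α) : Finset (List α) :=
  ⟨S.val.lists, Multiset.lists_nodup_finset S⟩

theorem mem_arrangements {S : Finset α} {l : List α} :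
    l ∈ arrangements S ↔ l.Nodup ∧ ∀ a, a ∈ l ↔ a ∈ S := by
  simp only [arrangements, Finset.mem_mk, Multiset.mem_lists_iff]
  constructor
  · intro h
    have hl : Multiset.Nodup ⟦l⟧ := h ▸ S.nodup
    exact ⟨hl, fun a => by rw [← mem_val, h]; rfl⟩
  · exact fun h => (Multiset.Nodup.ext S.nodup (Multiset.coe_nodup.2 h.1)).2 fun a => (h.2 a).symm

theorem length_of_mem_arrangements {S : Finset α} {l : List α} (h : l ∈ arrangements S) :
    l.length = #S :=
  (congrArg Multiset.card ((Multiset.mem_lists_iff _ _).1 h)).symm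

theorem arrangements_empty : arrangements (∅ : Finset α) = {[]} := by
  ext l
  simp only [mem_arrangements, notMem_empty, iff_false, ← List.eq_nil_iff_forall_not_mem,
    mem_singleton]
  exact ⟨And.right, fun h => ⟨h ▸ List.nodup_nil, h⟩⟩

theorem cons_mem_arrangements [DecidableEq α] {S : Finset α} {a : α} {l : List α} :
    a :: l ∈ arrangements S ↔ a ∈ S ∧ l ∈ arrangements (S.erase a) := by
  simp only [mem_arrangements, List.nodup_cons, List.mem_cons, mem_erase]
  grind

theorem sum_arrangements_of_nonempty [DecidableEq α] {M : Type*} [AddCommMonoid M]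
    {S : Finset α} (hS : S.Nonempty) (F : List α → M) :
    ∑ l ∈ arrangements S, F l = ∑ a ∈ S, ∑ l ∈ arrangements (S.erase a), F (a :: l) := by
  rw [sum_sigma']
  refine (sum_bij (fun y _ => y.1 :: y.2) ?_ ?_ ?_ fun _ _ => rfl).symm
  · exact fun y hy => cons_mem_arrangements.2 (mem_sigma.1 hy)
  · rintro ⟨a, l⟩ _ ⟨b, m⟩ _ h
    obtain ⟨rfl, rfl⟩ := List.cons.inj h
    rfl
  · rintro (_ | ⟨a, l⟩) hl
    · obtain ⟨a, ha⟩ := hS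
      simpa using ((mem_arrangements.1 hl).2 a).2 ha
    · exact ⟨⟨a, l⟩, mem_sigma.2 (cons_mem_arrangements.1 hl), rfl⟩

theorem sum_arrangements_image {β M : Type*} [DecidableEq β] [AddCommMonoid M] {f : α → β}
    {S : Finset α} (hf : Set.InjOn f S) (F : List β → M) :
    ∑ l ∈ arrangements (S.image f), F l = ∑ l ∈ arrangements S, F (l.map f) := by
  classical
  induction S using Finset.strongInduction generalizing F with
  | H S ih =>
    obtain rfl | hS := S.eq_empty_or_nonempty
    · simp [arrangements_empty]
    rw [sum_arrangements_of_nonempty (hS.image f), sum_arrangements_of_nonempty hS, sum_image hf]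
    refine sum_congr rfl fun a ha => ?_
    have herase : (S.image f).erase (f a) = (S.erase a).image f := by
      rw [← sdiff_singleton_eq_erase, ← sdiff_singleton_eq_erase, ← image_singleton,
        image_sdiff_of_injOn hf (singleton_subset_iff.2 ha)]
    rw [herase, ih _ (erase_ssubset ha) (hf.mono (by simp))]
    rfl

end Arrangements

section Descents

variable {α : Type*} [LinearOrder α]

/-- The number of descents of a word: the number of positions where a letter is followed by a
smaller one. -/
def descents : List α → ℕ
  | a :: b :: l => (if b < a then 1 else 0) + descents (b :: l)
  | _ => 0

theorem descents_cons_cons (a b : α) (l : List α) :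
    descents (a :: b :: l) = (if b < a then 1 else 0) + descents (b :: l) := by
  rw [descents]

theorem descents_map_of_strictMono {β : Type*} [LinearOrder β] {f : α → β} (hf : StrictMono f) :
    ∀ l : List α, descents (l.map f) = descents l
  | [] => rfl
  | [_] => rfl
  | a :: b :: l => by
    have ih := descents_map_of_strictMono hf (b :: l)
    rw [List.map_cons] at ih
    rw [List.map_cons, List.map_cons, descents_cons_cons, descents_cons_cons, ih]
    simp only [hf.lt_iff_lt]

theorem descents_map_range_succ (f : ℕ → α) (n : ℕ) :
    descents ((List.range (n + 1)).map f) = #{j ∈ range n | f (j + 1) < f j} := by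
  induction n generalizing f with
  | zero => rfl
  | succ n ih =>
    have h := ih (f ∘ Nat.succ)
    rw [List.range_succ_eq_map, List.map_cons] at h
    rw [List.range_succ_eq_map, List.map_cons, List.map_map, List.range_succ_eq_map,
      List.map_cons, descents_cons_cons, h, card_filter, card_filter, sum_range_succ', add_comm]
    rfl

/-- The descent generating polynomial of the arrangements of `S`. -/
noncomputable def descentPolynomial (S : Finset α) : ℤ[X] :=
  ∑ l ∈ arrangements S, X ^ descents l

/-- The Eulerian polynomial of type `A`, that is, of the symmetric group on `n` letters. -/
noncomputable def eulerianA (n : ℕ) : ℤ[X] := descentPolynomial (univ : Finset (Fin n))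

theorem descentPolynomial_empty : descentPolynomial (∅ : Finset α) = 1 := by
  simp [descentPolynomial, arrangements_empty, descents]

theorem descentPolynomial_eq_eulerianA (S : Finset α) :
    descentPolynomial S = eulerianA #S := by
  have hS : S = univ.image (S.orderEmbOfFin rfl) := (S.image_orderEmbOfFin_univ rfl).symm
  conv_lhs => rw [hS]
  rw [descentPolynomial, sum_arrangements_image (S.orderEmbOfFin rfl).injective.injOn]
  simp_rw [descents_map_of_strictMono (S.orderEmbOfFin rfl).strictMono]
  rfl

theorem descentPolynomial_of_nonempty {S : Finset α} (hS : S.Nonempty) :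
    descentPolynomial S = ∑ b ∈ S, ∑ l ∈ arrangements (S.erase b), X ^ descents (b :: l) := by
  rw [descentPolynomial, sum_arrangements_of_nonempty hS]

theorem sum_powerset_eq_add_sum_max {M : Type*} [AddCommMonoid M] (S : Finset α)
    (g : Finset α → M) :
    ∑ T ∈ S.powerset, g T =
      g ∅ + ∑ b ∈ S, ∑ T ∈ {a ∈ S | a < b}.powerset, g (insert b T) := by
  induction S using Finset.induction_on_max with
  | empty => simp
  | insert a S hmax ih =>
    have ha : a ∉ S := fun h => lt_irrefl a (hmax a h)
    have hfilter_max : {b ∈ insert a S | b < a} = S := by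
      rw [filter_insert, if_neg (lt_irrefl _), filter_true_of_mem hmax]
    have hfilter : ∀ b ∈ S, {c ∈ insert a S | c < b} = {c ∈ S | c < b} := fun b hb => by
      rw [filter_insert, if_neg (hmax b hb).not_gt]
    rw [sum_powerset_insert ha, ih, sum_insert ha, hfilter_max, add_assoc,
      add_comm (∑ T ∈ S.powerset, _)]
    congr 2
    exact sum_congr rfl fun b hb => by rw [hfilter b hb]

theorem sum_powerset_insert_descentPolynomial (S : Finset α) (b : α) :
    ∑ T ∈ {a ∈ S | a < b}.powerset,
        (X - 1) ^ #(insert b T) * descentPolynomial (S \ insert b T) =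
      (X - 1) * ∑ T ∈ {a ∈ S.erase b | a < b}.powerset,
        (X - 1) ^ #T * descentPolynomial (S.erase b \ T) := by
  have hfilter : {a ∈ S.erase b | a < b} = {a ∈ S | a < b} := by
    rw [filter_erase, erase_eq_of_notMem (by simp)]
  rw [hfilter, mul_sum]
  refine sum_congr rfl fun T hT => ?_
  have hbT : b ∉ T := fun h => by simpa using mem_powerset.1 hT h
  rw [card_insert_of_notMem hbT, pow_succ', mul_assoc, sdiff_insert, erase_sdiff_comm]

theorem sum_X_pow_descents_cons_of_nonempty {S : Finset α} (hS : S.Nonempty) (c : α) :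
    ∑ l ∈ arrangements S, (X : ℤ[X]) ^ descents (c :: l) =
      descentPolynomial S + (X - 1) * ∑ b ∈ S with b < c,
        ∑ l ∈ arrangements (S.erase b), X ^ descents (b :: l) := by
  have first_step (b : α) (l : List α) : (X : ℤ[X]) ^ descents (c :: b :: l) =
      X ^ descents (b :: l) + if b < c then (X - 1) * X ^ descents (b :: l) else 0 := by
    rw [descents_cons_cons, pow_add]
    split_ifs <;> ring
  simp_rw [sum_arrangements_of_nonempty hS, first_step, sum_add_distrib,
    ← descentPolynomial_of_nonempty hS, mul_sum, sum_filter]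
  refine congrArg _ (sum_congr rfl fun b _ => ?_)
  split_ifs <;> simp

/- Each descent contributes `X = 1 + (X - 1)`. Expanding these factors from the left and stopping at
the first `1` splits off an initial descending run, which is determined by its set `T` of
letters. -/
theorem sum_X_pow_descents_cons (S : Finset α) (c : α) :
    ∑ l ∈ arrangements S, (X : ℤ[X]) ^ descents (c :: l) =
      ∑ T ∈ {a ∈ S | a < c}.powerset, (X - 1) ^ #T * descentPolynomial (S \ T) := by
  induction S using Finset.strongInduction generalizing c with
  | H S ih =>
    obtain rfl | hS := S.eq_empty_or_nonempty
    · simp [arrangements_empty, descentPolynomial_empty, descents]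
    rw [sum_X_pow_descents_cons_of_nonempty hS, sum_powerset_eq_add_sum_max, mul_sum]
    simp only [card_empty, pow_zero, sdiff_empty, one_mul]
    refine congrArg _ (sum_congr rfl fun b hb => ?_)
    obtain ⟨hbS, hbc⟩ := mem_filter.1 hb
    have hfilter : {a ∈ {a ∈ S | a < c} | a < b} = {a ∈ S | a < b} := by
      rw [filter_filter]
      exact filter_congr fun a _ => ⟨And.right, fun h => ⟨h.trans hbc, h⟩⟩
    rw [ih _ (erase_ssubset hbS), hfilter, sum_powerset_insert_descentPolynomial]

theorem sum_powerset_descentPolynomial {S : Finset α} (hS : S.Nonempty) :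
    ∑ T ∈ S.powerset, (X - 1) ^ #T * descentPolynomial (S \ T) = X * descentPolynomial S := by
  rw [sum_powerset_eq_add_sum_max]
  simp_rw [sum_powerset_insert_descentPolynomial, ← sum_X_pow_descents_cons, ← mul_sum,
    ← descentPolynomial_of_nonempty hS, card_empty, pow_zero, sdiff_empty]
  ring

theorem eulerianA_zero : eulerianA 0 = 1 := descentPolynomial_empty

theorem sum_choose_mul_eulerianA {n : ℕ} (hn : n ≠ 0) :
    ∑ k ∈ range (n + 1), (n.choose k : ℤ[X]) * ((X - 1) ^ k * eulerianA (n - k)) =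
      X * eulerianA n := by
  have h := sum_powerset_descentPolynomial (S := (univ : Finset (Fin n)))
    (univ_nonempty_iff.2 (Fin.pos_iff_nonempty.1 (Nat.pos_of_ne_zero hn)))
  simp only [descentPolynomial_eq_eulerianA, card_sdiff_of_subset (subset_univ _)] at h
  rw [sum_powerset_apply_card fun k => (X - 1) ^ k * eulerianA (#(univ : Finset (Fin n)) - k)] at h
  simpa only [nsmul_eq_mul, card_fin] using h

end Descents

section SignedArrangements

/-- Reverses the signs of the letters in `U`. -/
def negOn (U : Finset ℤ) (a : ℤ) : ℤ := if a ∈ U then -a else a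

theorem abs_negOn (U : Finset ℤ) (a : ℤ) : |negOn U a| = |a| := by
  rw [negOn]
  split_ifs <;> simp

theorem negOn_injOn {S : Finset ℤ} (hS : ∀ a ∈ S, 0 < a) (U : Finset ℤ) :
    Set.InjOn (negOn U) S := fun a ha b hb h => by
  rw [← abs_of_pos (hS a ha), ← abs_of_pos (hS b hb), ← abs_negOn U a, h, abs_negOn]

theorem map_abs_map_negOn {l : List ℤ} (hl : ∀ a ∈ l, 0 < a) (U : Finset ℤ) :
    (l.map (negOn U)).map abs = l := by
  rw [List.map_map]
  refine (List.map_congr_left fun a ha => ?_).trans l.map_id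
  rw [Function.comp_apply, abs_negOn, abs_of_pos (hl a ha), id_eq]

/-- The signed arrangements of a set `S` of positive integers: the words that arise from the
arrangements of `S` by reversing the signs of some of the letters. -/
def signedArrangements (S : Finset ℤ) : Finset (List ℤ) :=
  (S.powerset ×ˢ arrangements S).image fun p => p.2.map (negOn p.1)

variable {S : Finset ℤ}

theorem pos_of_mem_Icc_one {n : ℕ} : ∀ a ∈ Icc (1 : ℤ) n, 0 < a :=
  fun _ ha => zero_lt_one.trans_le (mem_Icc.1 ha).1

theorem pos_of_mem_arrangements (hS : ∀ a ∈ S, 0 < a) {l : List ℤ} (hl : l ∈ arrangements S) :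
    ∀ a ∈ l, 0 < a :=
  fun a ha => hS a (((mem_arrangements.1 hl).2 a).1 ha)

theorem mem_signedArrangements (hS : ∀ a ∈ S, 0 < a) {m : List ℤ} :
    m ∈ signedArrangements S ↔ m.map abs ∈ arrangements S := by
  rw [signedArrangements, mem_image]
  constructor
  · rintro ⟨⟨U, l⟩, hp, rfl⟩
    obtain ⟨_, hl⟩ := mem_product.1 hp
    rwa [map_abs_map_negOn (pos_of_mem_arrangements hS hl)]
  · intro hm
    refine ⟨({a ∈ S | -a ∈ m}, m.map abs),
      mem_product.2 ⟨mem_powerset.2 (filter_subset _ _), hm⟩, ?_⟩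
    rw [List.map_map]
    refine (List.map_congr_left fun x hx => ?_).trans m.map_id
    have hxS : |x| ∈ S := ((mem_arrangements.1 hm).2 _).1 (List.mem_map_of_mem hx)
    have hx0 : x ≠ 0 := abs_pos.1 (hS _ hxS)
    have neg_notMem : -x ∉ m := fun hx' => by
      have := List.inj_on_of_nodup_map (mem_arrangements.1 hm).1 hx hx' (abs_neg x).symm
      omega
    obtain h | h := abs_choice x <;> rw [h] at hxS <;>
      simp [negOn, h, hx, hxS, neg_notMem]

theorem map_negOn_injOn (hS : ∀ a ∈ S, 0 < a) :
    Set.InjOn (fun p : Finset ℤ × List ℤ => p.2.map (negOn p.1))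
      (S.powerset ×ˢ arrangements S : Finset _) := by
  rintro ⟨U, l⟩ hp ⟨V, m⟩ hq h
  obtain ⟨hU, hl⟩ : U ∈ S.powerset ∧ l ∈ arrangements S := mem_product.1 hp
  obtain ⟨hV, hm⟩ : V ∈ S.powerset ∧ m ∈ arrangements S := mem_product.1 hq
  obtain rfl : l = m := by
    change l.map (negOn U) = m.map (negOn V) at h
    rw [← map_abs_map_negOn (pos_of_mem_arrangements hS hl) U, h,
      map_abs_map_negOn (pos_of_mem_arrangements hS hm)]
  have mem_iff (a : ℤ) (ha : a ∈ S) : a ∈ U ↔ a ∈ V := by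
    have hneg := List.map_inj_left.1 h a (((mem_arrangements.1 hl).2 a).2 ha)
    have := hS a ha
    simp only [negOn] at hneg
    grind
  refine congrArg (·, l) (Finset.ext fun a => ⟨fun ha => ?_, fun ha => ?_⟩)
  · exact (mem_iff a (mem_powerset.1 hU ha)).1 ha
  · exact (mem_iff a (mem_powerset.1 hV ha)).2 ha

theorem sum_signedArrangements {M : Type*} [AddCommMonoid M] (hS : ∀ a ∈ S, 0 < a)
    (F : List ℤ → M) :
    ∑ m ∈ signedArrangements S, F m =
      ∑ U ∈ S.powerset, ∑ l ∈ arrangements (S.image (negOn U)), F l := by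
  rw [signedArrangements, sum_image (map_negOn_injOn hS), sum_product]
  exact sum_congr rfl fun U _ => (sum_arrangements_image (negOn_injOn hS U) F).symm

theorem sum_signedArrangements_of_nonempty {M : Type*} [AddCommMonoid M] (hS : ∀ a ∈ S, 0 < a)
    (hne : S.Nonempty) (F : List ℤ → M) :
    ∑ m ∈ signedArrangements S, F m =
      ∑ a ∈ S, ∑ m ∈ signedArrangements (S.erase a), (F (a :: m) + F (-a :: m)) := by
  have hS' (a : ℤ) : ∀ b ∈ S.erase a, 0 < b := fun b hb => hS b (mem_of_mem_erase hb)
  rw [signedArrangements, sum_image (map_negOn_injOn hS), sum_product_right,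
    sum_arrangements_of_nonempty hne]
  refine sum_congr rfl fun a ha => ?_
  rw [signedArrangements, sum_image (map_negOn_injOn (hS' a)), sum_product_right]
  refine sum_congr rfl fun l hl => ?_
  have hal : a ∉ l := fun h => notMem_erase a S (((mem_arrangements.1 hl).2 a).1 h)
  have map_insert (U : Finset ℤ) : l.map (negOn (insert a U)) = l.map (negOn U) :=
    List.map_congr_left fun b hb => by
      have : b ≠ a := fun h => hal (h ▸ hb)
      simp [negOn, this]
  conv_lhs => rw [← insert_erase ha]
  rw [sum_powerset_insert (notMem_erase a S), ← sum_add_distrib]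
  refine sum_congr rfl fun U hU => ?_
  have haU : a ∉ U := fun h => notMem_erase a S (mem_powerset.1 hU h)
  simp [map_insert, negOn, haU]

theorem sum_X_pow_descents_signedArrangements (hS : ∀ a ∈ S, 0 < a) :
    ∑ m ∈ signedArrangements S, (X : ℤ[X]) ^ descents m = 2 ^ #S * eulerianA #S := by
  have h (U : Finset ℤ) :
      ∑ l ∈ arrangements (S.image (negOn U)), (X : ℤ[X]) ^ descents l = eulerianA #S := by
    rw [← card_image_of_injOn (negOn_injOn hS U)]
    exact descentPolynomial_eq_eulerianA _
  simp [sum_signedArrangements hS, h]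

theorem card_filter_image_negOn_neg (hS : ∀ a ∈ S, 0 < a) {U : Finset ℤ} (hU : U ⊆ S) :
    #{a ∈ S.image (negOn U) | a < 0} = #U := by
  have hfilter : {a ∈ S | negOn U a < 0} = U := by
    ext a
    have := @hU a
    have := hS a
    simp only [negOn]
    grind
  rw [filter_image, hfilter, card_image_of_injOn ((negOn_injOn hS U).mono hU)]

theorem sum_powerset_sum_powerset {α R : Type*} [CommSemiring R] (S : Finset α)
    (f : Finset α → R) :
    ∑ U ∈ S.powerset, ∑ T ∈ U.powerset, f T = ∑ T ∈ S.powerset, 2 ^ (#S - #T) * f T := by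
  classical
  have hmem (U T : Finset α) : U ∈ S.powerset ∧ T ∈ U.powerset ↔ U ∈ Icc T S ∧ T ∈ S.powerset := by
    simp only [mem_powerset, mem_Icc]
    exact ⟨fun h => ⟨⟨h.2, h.1⟩, h.2.trans h.1⟩, fun h => ⟨h.1.2, h.1.1⟩⟩
  rw [sum_comm' hmem]
  refine sum_congr rfl fun T hT => ?_
  rw [sum_const, card_Icc_finset (mem_powerset.1 hT), nsmul_eq_mul, Nat.cast_pow, Nat.cast_ofNat]

/-- The Eulerian polynomial of type `B`. The type `B` descents of a signed permutation are the
descents of its word preceded by the letter `0`. -/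
noncomputable def eulerianB (n : ℕ) : ℤ[X] :=
  ∑ m ∈ signedArrangements (Icc 1 n), X ^ descents (0 :: m)

theorem eulerianB_eq_sum (n : ℕ) :
    eulerianB n = ∑ k ∈ range (n + 1),
      (n.choose k : ℤ[X]) * ((X - 1) ^ k * (2 ^ (n - k) * eulerianA (n - k))) := by
  set S : Finset ℤ := Icc 1 n
  have hS : ∀ a ∈ S, 0 < a := pos_of_mem_Icc_one
  have hcard : #S = n := by simp [S]
  have sum_fixed_signs (U : Finset ℤ) (hU : U ∈ S.powerset) :
      ∑ l ∈ arrangements (S.image (negOn U)), (X : ℤ[X]) ^ descents (0 :: l) =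
        ∑ T ∈ U.powerset, (X - 1) ^ #T * eulerianA (n - #T) := by
    rw [sum_X_pow_descents_cons, sum_powerset_apply_card fun k => (X - 1) ^ k * eulerianA (n - k),
      ← card_filter_image_negOn_neg hS (mem_powerset.1 hU), ← sum_powerset_apply_card]
    refine sum_congr rfl fun T hT => ?_
    rw [descentPolynomial_eq_eulerianA,
      card_sdiff_of_subset ((mem_powerset.1 hT).trans (filter_subset _ _)),
      card_image_of_injOn (negOn_injOn hS U), hcard]
  rw [eulerianB, sum_signedArrangements hS, sum_congr rfl sum_fixed_signs,
    sum_powerset_sum_powerset,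
    sum_powerset_apply_card fun k => 2 ^ (#S - k) * ((X - 1) ^ k * eulerianA (n - k)), hcard]
  exact sum_congr rfl fun k _ => by rw [nsmul_eq_mul, mul_left_comm ((2 : ℤ[X]) ^ _)]

end SignedArrangements

section TypeD

/-- The number of type `D` descents of a signed word `m`: the number of descents after prefixing
`m` with the negative of its second letter. -/
def descentsD (m : List ℤ) : ℕ := descents (-(m.getD 1 0) :: m)

theorem descentsD_cons_cons (a y : ℤ) (m : List ℤ) :
    descentsD (a :: y :: m) =
      (if a < -y then 1 else 0) + ((if y < a then 1 else 0) + descents (y :: m)) := by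
  rw [← descents_cons_cons, ← descents_cons_cons]
  rfl

theorem descentsD_neg_cons_cons (a y : ℤ) (m : List ℤ) :
    descentsD (-a :: y :: m) = descentsD (a :: y :: m) := by
  simp only [descentsD_cons_cons, neg_lt_neg_iff, lt_neg (a := y), add_left_comm]

theorem X_pow_descents_zero_cons_add_neg {a y : ℤ} (ha : 0 < a) (hy : |y| ≠ a) (m : List ℤ) :
    (X : ℤ[X]) ^ descents (0 :: a :: y :: m) + X ^ descents (0 :: -a :: y :: m) =
      X ^ descentsD (a :: y :: m) + X * X ^ descents (y :: m) := by
  simp only [descentsD_cons_cons, descents_cons_cons, ha.not_gt, neg_lt_zero.2 ha, if_true,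
    if_false, zero_add, ← pow_succ']
  obtain h | h | h : a < y ∨ (-a < y ∧ y < a) ∨ y < -a := by grind
  · simp [show ¬y < a by omega, show ¬y < -a by omega, show ¬a < -y by omega, add_comm]
  · simp [h.2, show ¬y < -a by omega, show ¬a < -y by omega, add_comm]
  · simp only [h, show y < a by omega, show a < -y by omega, if_true]
    ring

theorem ite_even_countP_cons_add_ite_neg_cons {M : Type*} [AddCommMonoid M] {a : ℤ} (ha : 0 < a)
    (m : List ℤ) (c : M) :
    (if Even ((a :: m).countP (· < 0)) then c else 0) +
      (if Even ((-a :: m).countP (· < 0)) then c else 0) = c := by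
  by_cases h : Even (m.countP (· < 0)) <;>
    simp [ha, ha.not_gt, Nat.even_add_one, h]

variable {S : Finset ℤ}

/- The two words that differ in the sign of the first letter have the same type `D` descents, and
exactly one of them has an even number of negative letters. -/
theorem sum_X_pow_descents_zero_cons (hS : ∀ a ∈ S, 0 < a) (hcard : 2 ≤ #S) :
    ∑ m ∈ signedArrangements S, (X : ℤ[X]) ^ descents (0 :: m) =
      ∑ m ∈ signedArrangements S with Even (m.countP (· < 0)), X ^ descentsD m +
        (#S : ℤ[X]) * 2 ^ (#S - 1) * X * eulerianA (#S - 1) := by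
  have hne : S.Nonempty := card_pos.1 (by omega)
  have hS' (a : ℤ) : ∀ b ∈ S.erase a, 0 < b := fun b hb => hS b (mem_of_mem_erase hb)
  have sum_second (a : ℤ) (ha : a ∈ S) :
      ∑ m ∈ signedArrangements (S.erase a), X * (X : ℤ[X]) ^ descents m =
        2 ^ (#S - 1) * X * eulerianA (#S - 1) := by
    rw [← mul_sum, sum_X_pow_descents_signedArrangements (hS' a), card_erase_of_mem ha]
    ring
  rw [sum_filter, sum_signedArrangements_of_nonempty hS hne,
    sum_signedArrangements_of_nonempty hS hne, mul_assoc, mul_assoc, ← mul_assoc (2 ^ _),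
    ← nsmul_eq_mul, ← sum_const, ← sum_congr rfl sum_second, ← sum_add_distrib]
  refine sum_congr rfl fun a ha => ?_
  rw [← sum_add_distrib]
  refine sum_congr rfl fun m hm => ?_
  rw [mem_signedArrangements (hS' a), mem_arrangements] at hm
  obtain _ | ⟨y, m⟩ := m
  · have herase : S.erase a = ∅ :=
      eq_empty_of_forall_notMem fun b hb => by simpa using (hm.2 b).2 hb
    have hcard_erase := card_erase_of_mem ha
    rw [herase, card_empty] at hcard_erase
    omega
  · have hy : |y| ≠ a := (mem_erase.1 ((hm.2 _).1 (by simp))).1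
    rw [descentsD_neg_cons_cons, ite_even_countP_cons_add_ite_neg_cons (hS a ha),
      X_pow_descents_zero_cons_add_neg (hS a ha) hy]

end TypeD

section CoxeterGroups

variable {n : ℕ}

theorem mem_plusMinus {i : ℤ} : i ∈ plusMinus n ↔ |i| ∈ Icc (1 : ℤ) n := by
  rw [plusMinus, mem_erase, mem_Icc, mem_Icc, ← abs_le, Order.one_le_iff_pos, abs_pos]

theorem neg_mem_plusMinus {i : ℤ} (hi : i ∈ plusMinus n) : -i ∈ plusMinus n := by
  rwa [mem_plusMinus, abs_neg, ← mem_plusMinus]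

theorem natCast_add_one_mem_plusMinus {j : ℕ} (hj : j < n) : (j : ℤ) + 1 ∈ plusMinus n := by
  rw [mem_plusMinus, mem_Icc, abs_of_pos (by omega)]
  omega

theorem permValue_of_mem (π : Equiv.Perm (plusMinus n)) {i : ℤ} (hi : i ∈ plusMinus n) :
    permValue π i = π ⟨i, hi⟩ :=
  Equiv.Perm.ofSubtype_apply_of_mem π hi

theorem permValue_mem (π : Equiv.Perm (plusMinus n)) {i : ℤ} (hi : i ∈ plusMinus n) :
    permValue π i ∈ plusMinus n := by
  rw [permValue_of_mem π hi]
  exact (π ⟨i, hi⟩).2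

theorem permValue_injective (π : Equiv.Perm (plusMinus n)) :
    Function.Injective (permValue π) :=
  (Equiv.Perm.ofSubtype π).injective

theorem permValue_neg {π : Equiv.Perm (plusMinus n)} (hπ : π ∈ coxeterB n) {i : ℤ}
    (hi : i ∈ plusMinus n) : permValue π (-i) = -permValue π i :=
  (mem_filter.1 hπ).2 i hi

theorem exists_permValue_eq {v : ℤ → ℤ} (hv : Set.MapsTo v (plusMinus n) (plusMinus n))
    (hinj : Set.InjOn v (plusMinus n)) :
    ∃ π : Equiv.Perm (plusMinus n), ∀ i ∈ plusMinus n, permValue π i = v i :=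
  ⟨Equiv.ofBijective hv.restrict (Finite.injective_iff_bijective.1 (hv.restrict_inj.2 hinj)),
    fun _ hi => permValue_of_mem _ hi⟩

/-- The word `π(1) ⋯ π(n)`. -/
noncomputable def permWord (π : Equiv.Perm (plusMinus n)) : List ℤ :=
  (List.range n).map fun j : ℕ => permValue π (j + 1)

theorem permWord_mem_signedArrangements {π : Equiv.Perm (plusMinus n)} (hπ : π ∈ coxeterB n) :
    permWord π ∈ signedArrangements (Icc 1 n) := by
  rw [mem_signedArrangements pos_of_mem_Icc_one, permWord, List.map_map]
  have hnodup : ((List.range n).map (abs ∘ fun j : ℕ => permValue π (j + 1))).Nodup := by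
    refine List.nodup_range.map_on fun i _ j hj h => ?_
    have hj' := natCast_add_one_mem_plusMinus (List.mem_range.1 hj)
    obtain h | h := abs_eq_abs.1 h
    · have := permValue_injective π h
      omega
    · have := permValue_injective π (h.trans (permValue_neg hπ hj').symm)
      omega
  refine mem_arrangements.2 ⟨hnodup, fun a => ?_⟩
  have hsub : ((List.range n).map (abs ∘ fun j : ℕ => permValue π (j + 1))).toFinset ⊆
      Icc (1 : ℤ) n := fun x hx => by
    obtain ⟨j, hj, rfl⟩ := List.mem_map.1 (List.mem_toFinset.1 hx)
    exact mem_plusMinus.1 (permValue_mem π (natCast_add_one_mem_plusMinus (List.mem_range.1 hj)))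
  rw [← List.mem_toFinset, eq_of_subset_of_card_le hsub]
  simp [List.toFinset_card_of_nodup hnodup]

theorem permWord_injOn : Set.InjOn (permWord (n := n)) (coxeterB n) := fun π hπ ρ hρ h => by
  have eq_of_pos (i : ℤ) (hi : i ∈ plusMinus n) (hpos : 0 < i) :
      permValue π i = permValue ρ i := by
    rw [mem_plusMinus, abs_of_pos hpos, mem_Icc] at hi
    have hj : (i - 1).toNat < n := by omega
    have hcast : ((i - 1).toNat : ℤ) + 1 = i := by omega
    simpa only [hcast] using List.map_inj_left.1 h (i - 1).toNat (List.mem_range.2 hj)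
  ext ⟨i, hi⟩
  rw [← permValue_of_mem, ← permValue_of_mem]
  obtain hneg | rfl | hpos := lt_trichotomy i 0
  · have := eq_of_pos (-i) (neg_mem_plusMinus hi) (by omega)
    rwa [permValue_neg hπ hi, permValue_neg hρ hi, neg_inj] at this
  · simp [mem_plusMinus] at hi
  · exact eq_of_pos i hi hpos

/-- The odd function on the nonzero integers whose values at `1, 2, …` are the letters of `m`,
followed by zeros. -/
def oddExtension (m : List ℤ) (i : ℤ) : ℤ := i.sign * m.getD (i.natAbs - 1) 0

theorem oddExtension_neg (m : List ℤ) (i : ℤ) : oddExtension m (-i) = -oddExtension m i := by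
  simp [oddExtension]

theorem oddExtension_natCast_add_one (m : List ℤ) (j : ℕ) :
    oddExtension m (j + 1) = m.getD j 0 := by
  have : ((j : ℤ) + 1).natAbs - 1 = j := by omega
  rw [oddExtension, Int.sign_eq_one_of_pos (by omega), one_mul, this]

theorem exists_abs_oddExtension_eq_getElem {m : List ℤ} {i : ℤ} (hi : i ∈ plusMinus m.length) :
    ∃ h : i.natAbs - 1 < (m.map abs).length,
      |oddExtension m i| = (m.map abs)[i.natAbs - 1] := by
  rw [mem_plusMinus, mem_Icc, Order.one_le_iff_pos, abs_pos, Int.abs_eq_natAbs] at hi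
  have hlt : i.natAbs - 1 < m.length := by omega
  refine ⟨by simpa using hlt, ?_⟩
  rw [oddExtension, abs_mul, Int.abs_sign_of_ne_zero hi.1, one_mul, List.getElem_map,
    List.getD_eq_getElem _ _ hlt]

theorem oddExtension_mapsTo {m : List ℤ} (hm : m.map abs ∈ arrangements (Icc (1 : ℤ) m.length)) :
    Set.MapsTo (oddExtension m) (plusMinus m.length) (plusMinus m.length) := fun i hi => by
  obtain ⟨_, h⟩ := exists_abs_oddExtension_eq_getElem hi
  rw [mem_coe, mem_plusMinus, h, ← (mem_arrangements.1 hm).2]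
  exact List.getElem_mem _

theorem oddExtension_injOn {m : List ℤ} (hm : m.map abs ∈ arrangements (Icc (1 : ℤ) m.length)) :
    Set.InjOn (oddExtension m) (plusMinus m.length) := fun i hi j hj h => by
  obtain ⟨_, hi'⟩ := exists_abs_oddExtension_eq_getElem hi
  obtain ⟨_, hj'⟩ := exists_abs_oddExtension_eq_getElem hj
  have hindex := (mem_arrangements.1 hm).1.getElem_inj_iff.1
    (hi'.symm.trans ((congrArg abs h).trans hj'))
  have hval := oddExtension_mapsTo hm hj
  simp only [mem_coe, mem_plusMinus, mem_Icc, Order.one_le_iff_pos, abs_pos] at hi hj hval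
  obtain rfl | rfl : i = j ∨ i = -j := by omega
  · rfl
  · rw [oddExtension_neg] at h
    omega

theorem exists_permWord_eq {m : List ℤ} (hm : m ∈ signedArrangements (Icc 1 n)) :
    ∃ π ∈ coxeterB n, permWord π = m := by
  rw [mem_signedArrangements pos_of_mem_Icc_one] at hm
  obtain rfl : m.length = n := by simpa using length_of_mem_arrangements hm
  obtain ⟨π, hπ⟩ := exists_permValue_eq (oddExtension_mapsTo hm) (oddExtension_injOn hm)
  refine ⟨π, mem_filter.2 ⟨mem_univ _, fun i hi => ?_⟩, ?_⟩
  · rw [hπ i hi, hπ _ (neg_mem_plusMinus hi), oddExtension_neg]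
  · refine List.ext_getElem (by simp [permWord]) fun j _ hj => ?_
    simp [permWord, hπ _ (natCast_add_one_mem_plusMinus hj), oddExtension_natCast_add_one, hj]

theorem sum_coxeterB_permWord {M : Type*} [AddCommMonoid M] (F : List ℤ → M) :
    ∑ π ∈ coxeterB n, F (permWord π) = ∑ m ∈ signedArrangements (Icc 1 n), F m :=
  sum_bij (fun π _ => permWord π) (fun _ => permWord_mem_signedArrangements)
    (fun _ hπ _ hρ => permWord_injOn hπ hρ) (fun _ hm => by simpa using exists_permWord_eq hm)
    fun _ _ => rfl

theorem card_filter_Icc_one (p : ℤ → Prop) [DecidablePred p] :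
    #{i ∈ Icc (1 : ℤ) n | p i} = #{j ∈ range n | p (((j : ℕ) : ℤ) + 1)} := by
  have hIcc : Icc (1 : ℤ) n = (range n).image fun j : ℕ => (j : ℤ) + 1 := by
    ext i
    simp only [mem_Icc, mem_image, mem_range]
    exact ⟨fun _ => ⟨(i - 1).toNat, by omega, by omega⟩, by omega⟩
  rw [hIcc, filter_image, card_image_of_injective _ fun i j h => by simpa using h]

theorem countP_permWord (π : Equiv.Perm (plusMinus n)) :
    (permWord π).countP (· < 0) = #{i ∈ Icc (1 : ℤ) n | permValue π i < 0} := by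
  rw [card_filter_Icc_one, permWord, List.countP_map, List.countP_eq_length_filter]
  rfl

theorem desD_eq_descentsD (hn : 2 ≤ n) (π : Equiv.Perm (plusMinus n)) :
    desD π = descentsD (permWord π) := by
  have hsecond : (permWord π).getD 1 0 = permValue π 2 := by
    rw [List.getD_eq_getElem _ _ (by simpa [permWord] using Nat.lt_of_succ_le hn)]
    simp [permWord]
  have hword : (List.range (n + 1)).map (fun j : ℕ => wordD π j) =
      -permValue π 2 :: permWord π := by
    rw [List.range_succ_eq_map, List.map_cons, List.map_map]
    rfl
  rw [descentsD, hsecond, ← hword, descents_map_range_succ, desD, card_filter_Icc_one]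
  simp only [add_sub_cancel_right, gt_iff_lt, Nat.cast_add, Nat.cast_one]

theorem eulerianD_eq_sum_signedArrangements (hn : 2 ≤ n) :
    eulerianD n =
      ∑ m ∈ signedArrangements (Icc 1 n) with Even (m.countP (· < 0)), X ^ descentsD m := by
  rw [sum_filter, ← sum_coxeterB_permWord, eulerianD, coxeterD, sum_filter]
  simp_rw [countP_permWord, desD_eq_descentsD hn]

theorem eulerianB_eq_eulerianD_add (hn : 2 ≤ n) :
    eulerianB n = eulerianD n + (n : ℤ[X]) * 2 ^ (n - 1) * X * eulerianA (n - 1) := by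
  have hcard : #(Icc (1 : ℤ) n) = n := by simp
  rw [eulerianB, eulerianD_eq_sum_signedArrangements hn,
    sum_X_pow_descents_zero_cons pos_of_mem_Icc_one (hcard.symm ▸ hn), hcard]

end CoxeterGroups

section ExponentialGeneratingFunctions

open PowerSeries (rescale exp cos sin coeff C)

variable {K : Type*} [Field K]

/-- The exponential generating function of a sequence. -/
noncomputable def egf (a : ℕ → K) : PowerSeries K := PowerSeries.mk fun n => a n / n.factorial

theorem rescale_egf (c : K) (a : ℕ → K) : rescale c (egf a) = egf fun n => c ^ n * a n := by
  ext n
  simp [egf, mul_div_assoc]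

theorem egf_add (a b : ℕ → K) : egf a + egf b = egf (a + b) := by
  ext n
  simp [egf, add_div]

theorem C_mul_egf (c : K) (a : ℕ → K) : C c * egf a = egf fun n => c * a n := by
  ext n
  simp [egf, mul_div_assoc]

variable [CharZero K]

theorem egf_pow (c : K) : (egf fun n => c ^ n) = rescale c (exp K) := by
  ext n
  simp [egf, PowerSeries.coeff_exp, div_eq_mul_inv]

theorem factorial_mul_coeff_egf (a : ℕ → K) (n : ℕ) : n.factorial * coeff n (egf a) = a n := by
  rw [egf, PowerSeries.coeff_mk, mul_div_cancel₀ _ (Nat.cast_ne_zero.2 n.factorial_ne_zero)]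

theorem egf_mul_egf (a b : ℕ → K) :
    egf a * egf b = egf fun n => ∑ k ∈ range (n + 1), (n.choose k : K) * (a k * b (n - k)) := by
  ext n
  simp only [egf, PowerSeries.coeff_mul, PowerSeries.coeff_mk, sum_div,
    Nat.sum_antidiagonal_eq_sum_range_succ_mk]
  refine sum_congr rfl fun k hk => ?_
  have h := Nat.choose_mul_factorial_mul_factorial (Nat.lt_succ_iff.1 (mem_range.1 hk))
  have hn : (n.factorial : K) = n.choose k * k.factorial * (n - k).factorial := by
    rw [← h]
    push_cast
    rfl
  have hne : (n.choose k * k.factorial * (n - k).factorial : K) ≠ 0 :=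
    hn ▸ Nat.cast_ne_zero.2 n.factorial_ne_zero
  rw [hn]
  have := left_ne_zero_of_mul hne
  have := right_ne_zero_of_mul hne
  have := left_ne_zero_of_mul (left_ne_zero_of_mul hne)
  have := right_ne_zero_of_mul (left_ne_zero_of_mul hne)
  field_simp

theorem rescale_exp_mul_egf_eulerianA (x : K) :
    rescale (x - 1) (exp K) * egf (fun n => aeval x (eulerianA n)) =
      C x * egf (fun n => aeval x (eulerianA n)) + C (1 - x) := by
  have hconst : C (1 - x) = egf (Pi.single 0 (1 - x)) := by
    ext n
    obtain _ | n := n <;> simp [egf]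
  rw [hconst, ← egf_pow, egf_mul_egf, C_mul_egf, egf_add]
  congr 1
  ext n
  obtain rfl | hn := eq_or_ne n 0
  · simp [eulerianA_zero]
  · simpa [hn] using congrArg (aeval x) (sum_choose_mul_eulerianA hn)

theorem egf_eulerianB (x : K) :
    egf (fun n => aeval x (eulerianB n)) =
      rescale (x - 1) (exp K) * rescale 2 (egf fun n => aeval x (eulerianA n)) := by
  rw [rescale_egf, ← egf_pow, egf_mul_egf]
  congr 1
  ext n
  simp [eulerianB_eq_sum, map_ofNat]

theorem rescale_mul_exp_eq_cos_add_sin {c : K} (hc : c ^ 2 = -1) (a : K) :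
    rescale (c * a) (exp K) = rescale a (cos K) + C c * rescale a (sin K) := by
  ext n
  simp only [PowerSeries.coeff_rescale, PowerSeries.coeff_exp, cos, sin, map_add,
    PowerSeries.coeff_C_mul, PowerSeries.coeff_mk, mul_pow]
  obtain ⟨k, rfl | rfl⟩ := n.even_or_odd'
  · have hk : 2 * k / 2 = k := by omega
    simp only [even_two_mul, if_true, hk, pow_mul, hc, map_div₀, map_pow, map_neg, map_one,
      map_natCast, mul_zero, add_zero]
    ring
  · have hodd : ¬Even (2 * k + 1) := by simp
    have hk : (2 * k + 1) / 2 = k := by omega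
    simp only [hodd, if_false, hk, pow_succ, pow_mul, hc, map_div₀, map_pow, map_neg, map_one,
      map_natCast, mul_zero, zero_add]
    ring

end ExponentialGeneratingFunctions

section EvaluationAtNegOne

open PowerSeries (rescale exp cos sin coeff C)
open Complex (I)

theorem cos_mul_map_secSeries :
    cos ℂ * PowerSeries.map (algebraMap ℚ ℂ) secSeries = 1 := by
  rw [← PowerSeries.map_cos (algebraMap ℚ ℂ), ← map_mul, secSeries,
    PowerSeries.mul_inv_cancel _ (by simp [cos]), map_one]

theorem factorial_mul_coeff_map_tanSeries (n : ℕ) :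
    n.factorial * coeff n (PowerSeries.map (algebraMap ℚ ℂ) tanSeries) = tangentNumber n 1 := by
  simp [tangentNumber]

theorem factorial_mul_coeff_map_secSeries (n : ℕ) :
    n.factorial * coeff n (PowerSeries.map (algebraMap ℚ ℂ) secSeries) = secantNumber n 0 := by
  simp [secantNumber]

theorem rescale_one_exp_eq :
    rescale 1 (exp ℂ) = rescale I (cos ℂ) - C I * rescale I (sin ℂ) := by
  simpa [sub_eq_add_neg] using rescale_mul_exp_eq_cos_add_sin (c := -I) (by simp) I

theorem rescale_neg_one_exp_eq :
    rescale (-1) (exp ℂ) = rescale I (cos ℂ) + C I * rescale I (sin ℂ) := by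
  simpa using rescale_mul_exp_eq_cos_add_sin (c := I) (by simp) I

theorem rescale_cos_mul_egf_eulerianA :
    rescale I (cos ℂ) * egf (fun n => aeval (-1 : ℂ) (eulerianA n)) = rescale 1 (exp ℂ) := by
  set A := egf fun n => aeval (-1 : ℂ) (eulerianA n)
  have hA := rescale_exp_mul_egf_eulerianA (-1 : ℂ)
  have hexp : rescale 1 (exp ℂ) * rescale (-1 - 1) (exp ℂ) = rescale (-1) (exp ℂ) := by
    rw [PowerSeries.exp_mul_exp_eq_exp_add]
    norm_num
  have hcosh : rescale 1 (exp ℂ) + rescale (-1) (exp ℂ) = 2 * rescale I (cos ℂ) := by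
    rw [rescale_one_exp_eq, rescale_neg_one_exp_eq]
    ring
  have hC : C (-1 : ℂ) = -1 ∧ C (1 - -1 : ℂ) = 2 := by
    constructor <;> norm_num [map_ofNat]
  rw [hC.1, hC.2] at hA
  have h2 : (2 : PowerSeries ℂ) ≠ 0 := fun h =>
    two_ne_zero (α := ℂ) (by simpa [map_ofNat] using congrArg PowerSeries.constantCoeff h)
  refine mul_left_cancel₀ h2 ?_
  linear_combination (-A) * hcosh + rescale 1 (exp ℂ) * hA - A * hexp

theorem egf_eulerianA_neg_one :
    egf (fun n => aeval (-1 : ℂ) (eulerianA n)) =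
      1 - C I * rescale I (PowerSeries.map (algebraMap ℚ ℂ) tanSeries) := by
  have hcos := congrArg (rescale I) cos_mul_map_secSeries
  have hA := rescale_cos_mul_egf_eulerianA
  rw [tanSeries, map_mul, PowerSeries.map_sin]
  rw [rescale_one_exp_eq] at hA
  simp only [map_mul, map_one] at hcos ⊢
  set sec := rescale I (PowerSeries.map (algebraMap ℚ ℂ) secSeries)
  set A := egf fun n => aeval (-1 : ℂ) (eulerianA n)
  linear_combination sec * hA + (1 - A) * hcos

theorem egf_eulerianB_neg_one :
    egf (fun n => aeval (-1 : ℂ) (eulerianB n)) =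
      rescale (2 * I) (PowerSeries.map (algebraMap ℚ ℂ) secSeries) := by
  have hcos := congrArg (rescale (2 * I)) cos_mul_map_secSeries
  have hA := congrArg (rescale 2) rescale_cos_mul_egf_eulerianA
  have hexp : rescale (-1 - 1) (exp ℂ) * rescale 2 (exp ℂ) = 1 := by
    rw [PowerSeries.exp_mul_exp_eq_exp_add]
    norm_num [PowerSeries.rescale_zero]
  rw [egf_eulerianB]
  simp only [map_mul, map_one, PowerSeries.rescale_rescale, one_mul, mul_comm I] at hcos hA
  set sec := rescale (2 * I) (PowerSeries.map (algebraMap ℚ ℂ) secSeries)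
  linear_combination sec * rescale (-1 - 1) (exp ℂ) * hA + sec * hexp -
    rescale (-1 - 1) (exp ℂ) * rescale 2 (egf fun n => aeval (-1 : ℂ) (eulerianA n)) * hcos

theorem aeval_neg_one_eulerianA {n : ℕ} (hn : n ≠ 0) :
    aeval (-1 : ℂ) (eulerianA n) = -(I ^ (n + 1) * tangentNumber n 1) := by
  rw [← factorial_mul_coeff_egf (fun n => aeval (-1 : ℂ) (eulerianA n)), egf_eulerianA_neg_one,
    ← factorial_mul_coeff_map_tanSeries, map_sub, PowerSeries.coeff_C_mul,
    PowerSeries.coeff_rescale, PowerSeries.coeff_one, if_neg hn]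
  ring

theorem aeval_neg_one_eulerianB (n : ℕ) :
    aeval (-1 : ℂ) (eulerianB n) = (2 * I) ^ n * secantNumber n 0 := by
  rw [← factorial_mul_coeff_egf (fun n => aeval (-1 : ℂ) (eulerianB n)), egf_eulerianB_neg_one,
    ← factorial_mul_coeff_map_secSeries, PowerSeries.coeff_rescale]
  ring

theorem eval_neg_one_eulerianD {n : ℕ} (hn : 2 ≤ n) :
    (((eulerianD n).eval (-1) : ℤ) : ℂ) =
      (2 * I) ^ n * (secantNumber n 0 - n / 2 * tangentNumber (n - 1) 1) := by
  obtain ⟨m, rfl⟩ := Nat.exists_eq_add_of_le' (Nat.one_le_of_lt hn)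
  have hD : eulerianD (m + 1) =
      eulerianB (m + 1) - ((m + 1 : ℕ) : ℤ[X]) * 2 ^ m * X * eulerianA m :=
    eq_sub_of_add_eq (eulerianB_eq_eulerianD_add hn).symm
  have heval : (((eulerianD (m + 1)).eval (-1) : ℤ) : ℂ) = aeval (-1 : ℂ) (eulerianD (m + 1)) := by
    simpa using (Polynomial.aeval_algebraMap_apply ℂ (-1 : ℤ) (eulerianD (m + 1))).symm
  rw [heval, hD]
  simp only [map_sub, map_mul, map_pow, map_natCast, map_ofNat, Polynomial.aeval_X,
    aeval_neg_one_eulerianB, aeval_neg_one_eulerianA (show m ≠ 0 by omega), add_tsub_cancel_right]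
  ring

end EvaluationAtNegOne

theorem corollary2p2 :
    (∀ n : ℕ, 2 ≤ n → (eulerianD (2 * n - 1)).eval (-1) = 0) ∧
    (∀ n : ℕ, 1 ≤ n →
      (((eulerianD (2 * n)).eval (-1) : ℤ) : ℚ) =
        (-4) ^ n * (secantNumber (2 * n) 0 - n * tangentNumber (2 * n - 1) 1)) := by
  have hsq : (2 * Complex.I) ^ 2 = -4 := by
    rw [mul_pow, Complex.I_sq]
    norm_num
  constructor
  · intro n hn
    obtain ⟨m, rfl⟩ := Nat.exists_eq_add_of_le' (Nat.one_le_of_lt hn)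
    have h := eval_neg_one_eulerianD (n := 2 * m + 1) (by omega)
    rw [pow_succ, pow_mul, hsq] at h
    obtain ⟨q, hq⟩ : ∃ q : ℚ, (((eulerianD (2 * m + 1)).eval (-1) : ℤ) : ℂ) = q * Complex.I :=
      ⟨(-4) ^ m * 2 * (secantNumber (2 * m + 1) 0 -
        (2 * m + 1 : ℕ) / 2 * tangentNumber (2 * m) 1), by rw [h]; push_cast; ring⟩
    have hre := congrArg Complex.re hq
    rw [Complex.intCast_re, Complex.mul_I_re, Complex.ratCast_im, neg_zero] at hre
    exact_mod_cast hre
  · intro n hn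
    have h := eval_neg_one_eulerianD (n := 2 * n) (by omega)
    rw [pow_mul, hsq, Nat.cast_mul, Nat.cast_ofNat, mul_div_cancel_left₀ _ two_ne_zero] at h
    exact_mod_cast h
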